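/- \textbf{Theorem.} Every hyperbolic group is weakly amenable. Here a group $\Gamma$ is \emph{hyperbolic} if it has a finite generating set $S$ whose (right) Cayley graph is hyperbolic, i.e. there is $\delta>0$ such that for every geodesic triangle in the Cayley graph (with geodesics viewed as sequences of vertices) each edge is contained in the $\delta$-neighborhood of the union of the other two. The group $\Gamma$ is \emph{weakly amenable} if there are a constant $C\ge 0$ and finitely supported functions $\varphi_n\colon\Gamma\to\mathbb{C}$ $(n\in\mathbb{N})$ such that $\varphi_n\to 1$ pointwise and $\sup_n\|\varphi_n\|_{\mathrm{cb}}\le C$, where $\|\varphi\|_{\mathrm{cb}}$ denotes the completely bounded norm of the Schur multiplier $[A_{x,y}]_{x,y\in\Gamma}\mapsto[\varphi(x^{-1}y)A_{x,y}]_{x,y\in\Gamma}$ on $\mathbb{B}(\ell_2\Gamma)$. More precisely, for every finite generating set $S$ of $\Gamma$ whose Cayley graph is hyperbolic, with word length $|x|_S$ (the distance from $e$ to $x$ in the Cayley graph), there are a constant $C\ge 0$ and finitely supported functions $f_n\colon\mathbb{N}_0\to[0,1]$ with $f_n\to 1$ pointwise such that the functions $\varphi_n(x)=f_n(|x|_S)$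 are finitely supported on $\Gamma$, converge to $1$ pointwise, and satisfy $\sup_n\|\varphi_n\|_{\mathrm{cb}}\le C$. -/

import Mathlib

open Filter Topology
open scoped NNReal ENNReal

noncomputable section

/-! ### Hyperbolic graphs and hyperbolic groups -/

/-- `s` is (the vertex set of) a geodesic path from `x` to `y`: a sequence `p 0, …, p n` with
`p 0 = x`, `p n = y` and `d (p i) (p j) = |i - j|`. -/
def IsGeodesicPath {V : Type*} (Γ : SimpleGraph V) (x y : V) (s : Set V) : Prop :=
  ∃ (n : ℕ) (p : ℕ → V), p 0 = x ∧ p n = y ∧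
    (∀ i j : ℕ, i ≤ j → j ≤ n → Γ.dist (p i) (p j) = j - i) ∧
    s = p '' {i | i ≤ n}

/-- The open `R`-neighbourhood of a set of vertices for the graph distance. -/
def graphNeighborhood {V : Type*} (Γ : SimpleGraph V) (R : ℝ) (E : Set V) : Set V :=
  {x | ∃ y ∈ E, (Γ.dist x y : ℝ) < R}

/-- A connected graph is hyperbolic if for some `δ > 0` each edge of every geodesic triangle lies
in the `δ`-neighbourhood of the union of the other two edges. -/
def IsHyperbolicGraph {V : Type*} (Γ : SimpleGraph V) : Prop :=
  Γ.Connected ∧ ∃ δ : ℝ, 0 < δ ∧ ∀ (x y z : V) (s t u : Set V),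
    IsGeodesicPath Γ x y s → IsGeodesicPath Γ y z t → IsGeodesicPath Γ z x u →
      s ⊆ graphNeighborhood Γ δ (t ∪ u) ∧
      t ⊆ graphNeighborhood Γ δ (u ∪ s) ∧
      u ⊆ graphNeighborhood Γ δ (s ∪ t)

/-- `S` is a finite generating set of `G` whose Cayley graph is hyperbolic. -/
def IsHyperbolicGeneratingSet {G : Type*} [Group G] (S : Set G) : Prop :=
  S.Finite ∧ Subgroup.closure S = ⊤ ∧ IsHyperbolicGraph (SimpleGraph.mulCayley S)

/-- A hyperbolic group: a group with a finite generating set whose Cayley graph is hyperbolic. -/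
def IsHyperbolicGroup (G : Type*) [Group G] : Prop :=
  ∃ S : Set G, IsHyperbolicGeneratingSet S

/-- The word length of `g` with respect to `S`, i.e. the distance from `1` to `g` in the Cayley
graph. -/
def wordLength {G : Type*} [Group G] (S : Set G) (g : G) : ℕ :=
  (SimpleGraph.mulCayley S).dist 1 g

/-! ### Completely bounded norms and Schur multipliers -/

/-- The Hilbert space `ℓ₂(X)`. -/
abbrev Ell2 (X : Type*) : Type _ := lp (fun _ : X => ℂ) 2

/-- The space of bounded operators on `ℓ₂(X)`. -/
abbrev BEll2 (X : Type*) : Type _ := Ell2 X →L[ℂ] Ell2 X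

/-- The matrix coefficient `A_{x,y} = ⟨A δ_y, δ_x⟩ = (A δ_y)(x)`. -/
def matrixCoeff {X : Type*} (A : BEll2 X) (x y : X) : ℂ :=
  open Classical in (A (lp.single 2 y (1 : ℂ)) : X → ℂ) x

/-- The operator `v ↦ (∑ j, A i j (v j))_i` on the Hilbert space direct sum `H ⊕ ⋯ ⊕ H` given by a
matrix of operators on `H`. This is the identification of `M_n(𝔹(H))` with `𝔹(H ⊕ ⋯ ⊕ H)`, which
defines the norm of `M_n(𝔹(H))`. -/
def blockOperator {H : Type*} [NormedAddCommGroup H] [InnerProductSpace ℂ H] {n : ℕ}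
    (A : Matrix (Fin n) (Fin n) (H →L[ℂ] H)) :
    PiLp 2 (fun _ : Fin n => H) →L[ℂ] PiLp 2 (fun _ : Fin n => H) :=
  ((PiLp.continuousLinearEquiv 2 ℂ (fun _ : Fin n => H)).symm :
      (Fin n → H) →L[ℂ] PiLp 2 (fun _ : Fin n => H)) ∘L
    ContinuousLinearMap.pi fun i => ∑ j, A i j ∘L PiLp.proj 2 (fun _ : Fin n => H) j

/-- The completely bounded norm `sup_n ‖T ⊗ id_n‖` of a linear map `T` on `𝔹(H)`, where `T ⊗ id_n`
applies `T` to each entry of an element of `M_n(𝔹(H))`; it is `∞` if `T` is not completely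
bounded. -/
def cbNorm {H : Type*} [NormedAddCommGroup H] [InnerProductSpace ℂ H]
    (T : (H →L[ℂ] H) →ₗ[ℂ] (H →L[ℂ] H)) : ℝ≥0∞ :=
  ⨆ (n : ℕ) (A : Matrix (Fin n) (Fin n) (H →L[ℂ] H)) (_ : ‖blockOperator A‖ ≤ 1),
    ‖blockOperator (A.map T)‖ₑ

/-- `T` is the (everywhere defined) Schur multiplier `[A_{x,y}] ↦ [k(x,y) A_{x,y}]` on `𝔹(ℓ₂(X))`
associated with the kernel `k`. -/
def IsSchurMultiplier {X : Type*} (k : X → X → ℂ) (T : BEll2 X →ₗ[ℂ] BEll2 X) : Prop :=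
  ∀ (A : BEll2 X) (x y : X), matrixCoeff (T A) x y = k x y * matrixCoeff A x y

/-- The completely bounded norm of the Schur multiplier on `𝔹(ℓ₂(X))` associated with `k`. There is
at most one such multiplier `T`; if there is none (some `[k(x,y) A_{x,y}]` is not a bounded
operator), the value is `∞`. -/
def schurCbNorm {X : Type*} (k : X → X → ℂ) : ℝ≥0∞ :=
  ⨅ (T : BEll2 X →ₗ[ℂ] BEll2 X) (_ : IsSchurMultiplier k T), cbNorm T

/-! ### Weak amenability -/

/-- The norm `‖φ‖_cb` of a function `φ` on a group: the completely bounded norm of the Schur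
multiplier associated with `(x, y) ↦ φ (x⁻¹ y)`. -/
def multiplierCbNorm {G : Type*} [Group G] (φ : G → ℂ) : ℝ≥0∞ :=
  schurCbNorm fun x y => φ (x⁻¹ * y)

/-- The sequence `φ` witnesses weak amenability of `G` with constant `C`: it consists of finitely
supported functions, converges to `1` pointwise, and `sup_n ‖φ_n‖_cb ≤ C`. -/
def WitnessesWeakAmenability {G : Type*} [Group G] (C : ℝ≥0) (φ : ℕ → G → ℂ) : Prop :=
  (∀ n, (Function.support (φ n)).Finite) ∧
  (∀ g, Tendsto (fun n => φ n g) atTop (𝓝 1)) ∧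
  (⨆ n, multiplierCbNorm (φ n)) ≤ C

/-- Weak amenability with constant `C`. -/
def IsWeaklyAmenableWith (G : Type*) [Group G] (C : ℝ≥0) : Prop :=
  ∃ φ : ℕ → G → ℂ, WitnessesWeakAmenability C φ

/-- Weak amenability. -/
def IsWeaklyAmenable (G : Type*) [Group G] : Prop :=
  ∃ C : ℝ≥0, IsWeaklyAmenableWith G C

end

/-! In a hyperbolic Cayley graph the metric can be read off from uniformly finite sets. Let `T x t`
consist of the vertices nearly on a geodesic from x to 1 at height t. Then `T x ⌈N/2⌉` meets `T y
⌊N/2⌋` exactly when N ≤ |x| + |y| - d(x, y) (`descentSet_inter_nonempty_iff`, via Gromov's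
four-point inequality). By inclusion–exclusion over the nonempty subsets ω of the intersection, with
signs (-1)^(|ω|+1), the indicator of this condition is an inner product of a vector depending on x
and one depending on y. Their squared norms are at most a uniform B.

If c(n) = f(n) - f(n + 1), telescoping gives f(d(x, y)) = ∑ c(|x| + |y| - N) over all N ≤ |x| + |y|
- d(x, y). Here |x| + |y| - N = k + l with k = |x| - ⌈N/2⌉ and l = |y| - ⌊N/2⌋. A Hilbert–Schmidt
factorization of the Hankel matrix c(k + l), with factors of squared norm K, therefore makes f(d(x,
y)) an inner product of vectors of squared norm at most 2KB (`schurCbNorm_radial_le`). Such a kernel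
has completely bounded norm at most 2KB (`schurCbNorm_le_of_hasSum`).

For c(n) = (1 - r) r^n the Hankel matrix has rank one and trace at most 1. Cutting it off at n ≤ M
costs at most the sum of the removed entries, which is at most 1 for M large. So K ≤ 2 whatever r
is, and r → 1 gives an approximate unit with bound 4B. -/

namespace SimpleGraph

/-! ### Geodesics and the four-point inequality -/

variable {V : Type*} {Γ : SimpleGraph V}

theorem Connected.exists_geodesic (hΓ : Γ.Connected) (x y : V) :
    ∃ p : ℕ → V, p 0 = x ∧ p (Γ.dist x y) = y ∧
      ∀ i j : ℕ, i ≤ j → j ≤ Γ.dist x y → Γ.dist (p i) (p j) = j - i := by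
  obtain ⟨w, hw⟩ := hΓ.exists_walk_length_eq_dist x y
  have key : ∀ i j, i ≤ j → Γ.dist (w.getVert i) (w.getVert j) ≤ j - i := by
    intro i j hij
    have := Γ.dist_le ((w.drop i).take (j - i))
    rw [Walk.take_length, Walk.drop_getVert, Nat.add_sub_cancel' hij] at this
    omega
  refine ⟨w.getVert, w.getVert_zero, by rw [← hw, w.getVert_length], fun i j hij hj => ?_⟩
  have h1 := key 0 i (Nat.zero_le _)
  have h2 := key i j hij
  have h3 := key j _ hj
  have t1 := hΓ.dist_triangle (u := x) (v := w.getVert i) (w := y)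
  have t2 := hΓ.dist_triangle (u := w.getVert i) (v := w.getVert j) (w := y)
  rw [w.getVert_zero] at h1
  rw [← hw, w.getVert_length] at h3
  omega

theorem Connected.exists_dist_eq (hΓ : Γ.Connected) (x y : V) {k : ℕ} (hk : k ≤ Γ.dist x y) :
    ∃ w, Γ.dist x w = k ∧ Γ.dist w y = Γ.dist x y - k := by
  obtain ⟨p, h0, h1, hp⟩ := hΓ.exists_geodesic x y
  refine ⟨p k, ?_, ?_⟩
  · simpa [h0] using hp 0 k (Nat.zero_le _) hk
  · simpa [h1] using hp k _ hk le_rfl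

theorem Connected.dist_add_dist_le_of_near_geodesic (hΓ : Γ.Connected) {a b p : V} {s : Set V}
    {k : ℕ} (hs : IsGeodesicPath Γ a b s) (h : ∃ q ∈ s, Γ.dist p q ≤ k) :
    Γ.dist a p + Γ.dist p b ≤ Γ.dist a b + 2 * k := by
  obtain ⟨n, f, rfl, rfl, hf, rfl⟩ := hs
  obtain ⟨_, ⟨i, hi, rfl⟩, hq⟩ := h
  have h1 := hf 0 i (Nat.zero_le _) hi
  have h2 := hf i n hi le_rfl
  have h3 := hf 0 n (Nat.zero_le _) le_rfl
  have t1 := hΓ.dist_triangle (u := f 0) (v := f i) (w := p)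
  have t2 := hΓ.dist_triangle (u := p) (v := f i) (w := f n)
  rw [dist_comm (u := f i)] at t1
  have hi' : i ≤ n := hi
  omega

end SimpleGraph

theorem exists_maximal_le {P : ℕ → Prop} {L : ℕ} (h0 : P 0) :
    ∃ i ≤ L, P i ∧ (i = L ∨ ¬ P (i + 1)) := by
  classical
  refine ⟨Nat.findGreatest P L, Nat.findGreatest_le L, Nat.findGreatest_spec (Nat.zero_le L) h0, ?_⟩
  rcases (Nat.findGreatest_le (P := P) L).eq_or_lt with h | h
  · exact Or.inl h
  · exact Or.inr (Nat.findGreatest_is_greatest (Nat.lt_succ_self _) h)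

/-- Gromov's four-point inequality in a hyperbolic graph. -/
theorem IsHyperbolicGraph.exists_four_point {V : Type*} {Γ : SimpleGraph V}
    (h : IsHyperbolicGraph Γ) :
    ∃ D : ℕ, ∀ x y z w : V, Γ.dist x y + Γ.dist z w ≤
      max (Γ.dist x z + Γ.dist y w) (Γ.dist x w + Γ.dist y z) + D := by
  obtain ⟨hΓ, δ, -, hδ⟩ := h
  obtain ⟨k, hk⟩ := exists_nat_ge δ
  refine ⟨4 * (k + 1), fun x y z w => ?_⟩
  obtain ⟨p, hp0, hpL, hp⟩ := hΓ.exists_geodesic x y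
  set L := Γ.dist x y with hL
  have geod (a b : V) : ∃ s, IsGeodesicPath Γ a b s := by
    obtain ⟨q, h0, h1, hq⟩ := hΓ.exists_geodesic a b
    exact ⟨_, _, q, h0, h1, hq, rfl⟩
  have hpx (i : ℕ) (hi : i ≤ L) : Γ.dist x (p i) = i := by
    simpa [hp0] using hp 0 i (Nat.zero_le _) hi
  have hpy (i : ℕ) (hi : i ≤ L) : Γ.dist (p i) y = L - i := by
    simpa [hpL] using hp i L hi le_rfl
  have insize (z : V) : ∃ i ≤ L, i + Γ.dist (p i) z ≤ Γ.dist x z + 2 * (k + 1) ∧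
      (L - i) + Γ.dist (p i) z ≤ Γ.dist y z + 2 * (k + 1) := by
    obtain ⟨t, ht⟩ := geod y z
    obtain ⟨u, hu⟩ := geod z x
    obtain ⟨hs, -⟩ := hδ x y z _ t u ⟨L, p, hp0, hpL, hp, rfl⟩ ht hu
    have hxu : x ∈ u := by
      obtain ⟨n, q, h0, h1, -, rfl⟩ := hu
      exact ⟨n, le_refl n, h1⟩
    have hyt : y ∈ t := by
      obtain ⟨n, q, h0, h1, -, rfl⟩ := ht
      exact ⟨0, Nat.zero_le n, h0⟩
    have hor (i : ℕ) (hi : i ≤ L) :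
        (∃ q ∈ u, Γ.dist (p i) q ≤ k) ∨ ∃ q ∈ t, Γ.dist (p i) q ≤ k := by
      obtain ⟨q, hq, hd⟩ := hs ⟨i, hi, rfl⟩
      have : Γ.dist (p i) q ≤ k := by exact_mod_cast (hd.trans_le hk).le
      exact hq.elim (fun h => Or.inr ⟨q, h, this⟩) (fun h => Or.inl ⟨q, h, this⟩)
    -- At a vertex near u which is y or whose successor is not near u, that successor is near t;
    -- hence the vertex is within k + 1 of both sides.
    obtain ⟨i, hi, hPi, hmax⟩ := exists_maximal_le (L := L)
      (P := fun i => ∃ q ∈ u, Γ.dist (p i) q ≤ k) ⟨x, hxu, by simp [hp0]⟩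
    have hQ : ∃ q ∈ t, Γ.dist (p i) q ≤ k + 1 := by
      rcases hmax with rfl | hmax
      · exact ⟨y, hyt, by simp [hpL]⟩
      · rcases hi.eq_or_lt with rfl | hi
        · exact ⟨y, hyt, by simp [hpL]⟩
        · obtain ⟨q, hq, hd⟩ := (hor (i + 1) hi).resolve_left hmax
          refine ⟨q, hq, ?_⟩
          have := hΓ.dist_triangle (u := p i) (v := p (i + 1)) (w := q)
          have := hp i (i + 1) (Nat.le_succ i) hi
          omega
    have h1 := hΓ.dist_add_dist_le_of_near_geodesic hu hPi
    have h2 := hΓ.dist_add_dist_le_of_near_geodesic ht hQ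
    have h3 := hpx i hi
    have h4 := hpy i hi
    rw [SimpleGraph.dist_comm (u := p i) (v := x), SimpleGraph.dist_comm (u := z) (v := p i),
      SimpleGraph.dist_comm (u := z) (v := x)] at h1
    rw [SimpleGraph.dist_comm (u := y) (v := p i)] at h2
    exact ⟨i, hi, by omega, by omega⟩
  obtain ⟨i, hi, hi1, hi2⟩ := insize z
  obtain ⟨j, hj, hj1, hj2⟩ := insize w
  have t1 := hΓ.dist_triangle (u := z) (v := p i) (w := w)
  rw [SimpleGraph.dist_comm (u := z) (v := p i)] at t1
  have t2 := hΓ.dist_triangle (u := p i) (v := p j) (w := w)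
  -- For i ≤ j, L + (j - i) = (L - i) + j pairs z with y and w with x; the other order gives the
  -- other term of the maximum.
  rcases le_total i j with hij | hij
  · have := hp i j hij hj
    omega
  · have := hp j i hij hi
    rw [SimpleGraph.dist_comm] at this
    omega

/-- The points `w` lying, up to an error `R`, on a geodesic from `x` to the base point `o` at height
`t` above `o`, with `d(x, w) ≤ d(o, x) - t`; for `t ≤ 0` these are points near `o`. -/
def descentSet {V : Type*} (Γ : SimpleGraph V) (o : V) (R : ℕ) (x : V) (t : ℤ) : Set V :=
  {w | (Γ.dist x w : ℤ) + t ≤ Γ.dist o x ∧ (Γ.dist o w : ℤ) ≤ max t 0 + R}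

/-! ### Descent sets encode the metric -/

section FourPoint

variable {V : Type*} {Γ : SimpleGraph V} {D : ℕ}

/-- A common point w gives the bound by the triangle inequality through w, since (N + 1) / 2 + N / 2
= N. Conversely w is chosen on a geodesic, and the four-point inequality controls its remaining
distance. -/
theorem descentSet_inter_nonempty_iff (hΓ : Γ.Connected)
    (hD : ∀ x y z w : V, Γ.dist x y + Γ.dist z w ≤
      max (Γ.dist x z + Γ.dist y w) (Γ.dist x w + Γ.dist y z) + D) (o x y : V) (N : ℤ) :
    (descentSet Γ o (3 * D + 2) x ((N + 1) / 2) ∩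
      descentSet Γ o (3 * D + 2) y (N / 2)).Nonempty ↔
      N + Γ.dist x y ≤ Γ.dist o x + Γ.dist o y := by
  constructor
  · rintro ⟨w, ⟨h1, -⟩, h2, -⟩
    have := hΓ.dist_triangle (u := x) (v := w) (w := y)
    rw [SimpleGraph.dist_comm (u := w)] at this
    omega
  · intro hN
    have t1 := hΓ.dist_triangle (u := o) (v := x) (w := y)
    have t2 := hΓ.dist_triangle (u := o) (v := y) (w := x)
    have t3 := hΓ.dist_triangle (u := x) (v := o) (w := y)
    rw [SimpleGraph.dist_comm (u := y) (v := x)] at t2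
    rw [SimpleGraph.dist_comm (u := x) (v := o)] at t3
    rcases le_or_gt N 0 with hN0 | hN0
    · refine ⟨o, ⟨?_, ?_⟩, ?_, ?_⟩ <;>
        simp only [SimpleGraph.dist_self, SimpleGraph.dist_comm (v := o)] <;> omega
    obtain ⟨m, rfl⟩ := Int.eq_ofNat_of_zero_le hN0.le
    -- If the Gromov product of x and y exceeds m / 2 by at most D, a point of a geodesic from x to
    -- y works: its height exceeds m / 2 by at most 2D + D, up to rounding.
    by_cases hn : Γ.dist o x + Γ.dist o y ≤ m + Γ.dist x y + 2 * D
    · obtain ⟨w, hw1, hw2⟩ := hΓ.exists_dist_eq x y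
        (k := min (Γ.dist o x - (m + 1) / 2) (Γ.dist x y)) (min_le_right _ _)
      have h4 := hD x y o w
      rw [SimpleGraph.dist_comm (u := x) (v := o), SimpleGraph.dist_comm (u := y) (v := o),
        SimpleGraph.dist_comm (u := y) (v := w)] at h4
      refine ⟨w, ⟨?_, ?_⟩, ?_, ?_⟩
      · omega
      · omega
      · rw [SimpleGraph.dist_comm]; omega
      · omega
    -- Otherwise w is taken on a geodesic from o to x; raising it by D pays for the four-point error
    -- in d(w, y).
    · obtain ⟨w, hw1, hw2⟩ := hΓ.exists_dist_eq o x (k := (m + 1) / 2 + D) (by omega)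
      have h4 := hD o x w y
      rw [SimpleGraph.dist_comm (u := x) (v := w)] at h4
      refine ⟨w, ⟨?_, ?_⟩, ?_, ?_⟩
      · rw [SimpleGraph.dist_comm]; omega
      · omega
      · rw [SimpleGraph.dist_comm]; omega
      · omega

/-- For 0 < t ≤ d(o, x) the centre is the point at height t on a geodesic from o to x, and the
radius comes from the four-point inequality. Above d(o, x) the set is empty. -/
theorem exists_descentSet_subset_closedBall (hΓ : Γ.Connected)
    (hD : ∀ x y z w : V, Γ.dist x y + Γ.dist z w ≤
      max (Γ.dist x z + Γ.dist y w) (Γ.dist x w + Γ.dist y z) + D) (o : V) (R : ℕ) (x : V) (t : ℤ) :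
    ∃ u, descentSet Γ o R x t ⊆ {w | Γ.dist u w ≤ R + D} := by
  rcases le_or_gt t 0 with ht | ht
  · refine ⟨o, ?_⟩
    rintro w ⟨-, h⟩
    simp only [Set.mem_ofPred_eq]
    omega
  obtain ⟨m, rfl⟩ := Int.eq_ofNat_of_zero_le ht.le
  by_cases hm : m ≤ Γ.dist o x
  · obtain ⟨u, hu1, hu2⟩ := hΓ.exists_dist_eq o x hm
    refine ⟨u, ?_⟩
    rintro w ⟨h1, h2⟩
    have := hD o x u w
    rw [SimpleGraph.dist_comm (u := x) (v := u)] at this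
    simp only [Set.mem_ofPred_eq]
    omega
  · refine ⟨o, ?_⟩
    rintro w ⟨h, -⟩
    omega

end FourPoint

/-! ### Balls in Cayley graphs -/

namespace SimpleGraph

variable {G : Type*} [Group G] {S : Set G}

theorem mulCayley_dist_mul_left (S : Set G) (g x y : G) :
    (mulCayley S).dist (g * x) (g * y) = (mulCayley S).dist x y := by
  have key (g x y : G) : (mulCayley S).edist (g * x) (g * y) ≤ (mulCayley S).edist x y := by
    rcases eq_or_ne ((mulCayley S).edist x y) ⊤ with h | h
    · rw [h]; exact le_top
    · obtain ⟨w, hw⟩ := exists_walk_of_edist_ne_top h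
      let f : mulCayley S →g mulCayley S :=
        ⟨fun a => g * a, fun {a b} h => (mulCayley_adj_mul_iff_right (d := g)).2 h⟩
      rw [← hw, ← Walk.length_map f w]
      exact edist_le _
  have h : (mulCayley S).edist (g * x) (g * y) = (mulCayley S).edist x y := by
    refine (key g x y).antisymm ?_
    simpa using key g⁻¹ (g * x) (g * y)
  rw [dist, dist, h]

theorem mulCayley_finite_closedBall_one (hS : S.Finite) (hc : (mulCayley S).Connected) (n : ℕ) :
    {g : G | (mulCayley S).dist 1 g ≤ n}.Finite := by
  induction n with
  | zero =>
    refine (Set.finite_singleton 1).subset fun g hg => ?_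
    have := (hc.dist_eq_zero_iff (u := 1) (v := g)).1 (Nat.le_zero.1 hg)
    exact this.symm
  | succ n ih =>
    refine ((ih.union (ih.mul hS)).union (ih.mul hS.inv)).subset fun g hg => ?_
    have hg' : (mulCayley S).dist 1 g ≤ n + 1 := hg
    rcases Nat.lt_or_ge n ((mulCayley S).dist 1 g) with h | h
    · obtain ⟨w, hw1, hw2⟩ := hc.exists_dist_eq 1 g h.le
      have hadj : (mulCayley S).Adj w g := by
        rw [← dist_eq_one_iff_adj]
        omega
      rw [mulCayley_adj] at hadj
      rcases hadj.2 with h | h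
      · exact Or.inl (Or.inr ⟨w, hw1.le, _, h, by simp⟩)
      · exact Or.inr ⟨w, hw1.le, w⁻¹ * g, by simpa using h, by simp⟩
    · exact Or.inl (Or.inl h)

theorem mulCayley_ncard_closedBall (S : Set G) (g : G) (n : ℕ) :
    {x | (mulCayley S).dist g x ≤ n}.ncard = {x | (mulCayley S).dist 1 x ≤ n}.ncard := by
  rw [← Set.ncard_image_of_injective {x | (mulCayley S).dist 1 x ≤ n} (mul_right_injective g)]
  congr 1
  ext x
  simp only [Set.mem_ofPred_eq, Set.mem_image]
  constructor
  · intro h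
    refine ⟨g⁻¹ * x, ?_, by simp⟩
    rw [← mulCayley_dist_mul_left S g]
    simpa using h
  · rintro ⟨y, hy, rfl⟩
    rw [← mulCayley_dist_mul_left S g] at hy
    simpa using hy

theorem mulCayley_finite_closedBall (hS : S.Finite) (hc : (mulCayley S).Connected) (g : G)
    (n : ℕ) : {x | (mulCayley S).dist g x ≤ n}.Finite := by
  refine ((mulCayley_finite_closedBall_one hS hc n).image (g * ·)).subset fun x hx => ?_
  refine ⟨g⁻¹ * x, ?_, by simp⟩
  have := mulCayley_dist_mul_left S g 1 (g⁻¹ * x)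
  simp only [mul_one, mul_inv_cancel_left] at this
  rw [Set.mem_ofPred_eq, ← this]
  exact hx

end SimpleGraph

/-! ### Completely bounded norms of compressions and Schur multipliers -/

noncomputable section

namespace lp

variable {I : Type*} {E : I → Type*} [∀ i, NormedAddCommGroup (E i)]

theorem hasSum_norm_sq (f : lp E 2) : HasSum (fun i => ‖f i‖ ^ 2) (‖f‖ ^ 2) := by
  simpa using lp.hasSum_norm (p := 2) (by simp) f

theorem memℓp_two_of_summable {f : ∀ i, E i} (hf : Summable fun i => ‖f i‖ ^ 2) :
    Memℓp f 2 :=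
  memℓp_gen (by simpa using hf)

section OfFamily

variable {H F : Type*} [NormedAddCommGroup H] [NormedSpace ℂ H] [NormedAddCommGroup F]
  [NormedSpace ℂ F]

/-- A square-summable family of linear maps, as an operator into the `ℓ²`-sum. -/
def ofFamily (T : I → H →ₗ[ℂ] F) (K : ℝ) (hs : ∀ u, Summable fun i => ‖T i u‖ ^ 2)
    (hK : ∀ u, ∑' i, ‖T i u‖ ^ 2 ≤ K * ‖u‖ ^ 2) : H →L[ℂ] lp (fun _ : I => F) 2 :=
  LinearMap.mkContinuous
    { toFun := fun u => (⟨fun i => T i u, memℓp_two_of_summable (hs u)⟩ : lp (fun _ : I => F) 2)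
      map_add' := fun u v => Subtype.ext (funext fun i => map_add (T i) u v)
      map_smul' := fun c u => Subtype.ext (funext fun i => map_smul (T i) c u) }
    (√K) fun u => by
      have h := (hasSum_norm_sq
        (⟨fun i => T i u, memℓp_two_of_summable (hs u)⟩ : lp (fun _ : I => F) 2)).tsum_eq
      rw [← Real.sqrt_sq (norm_nonneg u), ← Real.sqrt_mul' K (sq_nonneg _)]
      exact Real.le_sqrt_of_sq_le (h.symm.trans_le (hK u))

theorem norm_ofFamily_sq_le (T : I → H →ₗ[ℂ] F) (K : ℝ) (hs) (hK) (u : H) :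
    ‖ofFamily T K hs hK u‖ ^ 2 ≤ K * ‖u‖ ^ 2 :=
  (hasSum_norm_sq (ofFamily T K hs hK u)).tsum_eq.symm.trans_le (hK u)

theorem summable_and_tsum_le_of_norm_le {T : I → lp (fun _ : I => F) 2 →ₗ[ℂ] F} {C : ℝ}
    (h : ∀ i f, ‖T i f‖ ≤ C * ‖f i‖) (f : lp (fun _ : I => F) 2) :
    (Summable fun i => ‖T i f‖ ^ 2) ∧ ∑' i, ‖T i f‖ ^ 2 ≤ C ^ 2 * ‖f‖ ^ 2 := by
  have hs : HasSum (fun i => C ^ 2 * ‖f i‖ ^ 2) (C ^ 2 * ‖f‖ ^ 2) := (hasSum_norm_sq f).mul_left _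
  have hle (i : I) : ‖T i f‖ ^ 2 ≤ C ^ 2 * ‖f i‖ ^ 2 := by
    rw [← mul_pow]
    exact pow_le_pow_left₀ (norm_nonneg _) (h i f) 2
  have hs' := hs.summable.of_nonneg_of_le (fun _ => sq_nonneg _) hle
  exact ⟨hs', hasSum_le hle hs'.hasSum hs⟩

end OfFamily

/-- The diagonal operator `A ⊕ A ⊕ ⋯` on an infinite Hilbert sum of copies of `H`. -/
def amplification (I : Type*) {H : Type*} [NormedAddCommGroup H] [InnerProductSpace ℂ H]
    (A : H →L[ℂ] H) : lp (fun _ : I => H) 2 →L[ℂ] lp (fun _ : I => H) 2 :=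
  have h := summable_and_tsum_le_of_norm_le
    (T := fun i : I => (A : H →ₗ[ℂ] H) ∘ₗ evalₗ (𝕜 := ℂ) (fun _ : I => H) 2 i)
    (C := ‖A‖) fun i f => A.le_opNorm (f i)
  ofFamily (fun i => (A : H →ₗ[ℂ] H) ∘ₗ evalₗ (𝕜 := ℂ) (fun _ : I => H) 2 i) (‖A‖ ^ 2)
    (fun f => (h f).1)
    fun f => (h f).2

@[simp]
theorem amplification_apply {I H : Type*} [NormedAddCommGroup H] [InnerProductSpace ℂ H]
    (A : H →L[ℂ] H) (f : lp (fun _ : I => H) 2) (i : I) : amplification I A f i = A (f i) := rfl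

end lp

section Compression

variable {I H : Type*} [NormedAddCommGroup H] [InnerProductSpace ℂ H] [CompleteSpace H]

/-- The map `A ↦ V* (A ⊗ 1) W`. -/
def compressionMap (V W : H →L[ℂ] lp (fun _ : I => H) 2) : (H →L[ℂ] H) →ₗ[ℂ] (H →L[ℂ] H) where
  toFun A := V.adjoint ∘L lp.amplification I A ∘L W
  map_add' A B := by
    have : lp.amplification I (A + B) = lp.amplification I A + lp.amplification I B := by
      ext f i; simp
    rw [this]; simp
  map_smul' c A := by
    have : lp.amplification I (c • A) = c • lp.amplification I A := by
      ext f i; simp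
    rw [this]; simp

theorem hasSum_inner_compressionMap (V W : H →L[ℂ] lp (fun _ : I => H) 2) (A : H →L[ℂ] H)
    (v u : H) :
    HasSum (fun i => inner ℂ (A (W v i)) (V u i)) (inner ℂ (compressionMap V W A v) u) := by
  have := lp.hasSum_inner (𝕜 := ℂ) (lp.amplification I A (W v)) (V u)
  rw [← ContinuousLinearMap.adjoint_inner_left] at this
  exact this

omit [CompleteSpace H] in
@[simp]
theorem blockOperator_apply {n : ℕ} (A : Matrix (Fin n) (Fin n) (H →L[ℂ] H))
    (v : PiLp 2 (fun _ : Fin n => H)) (j : Fin n) :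
    blockOperator A v j = ∑ k, A j k (v k) := by
  simp [blockOperator]

/-- Collecting the i-th coordinates of all n components into vectors p_i, q_i of H^n turns the
pairing into ∑ ⟨A p_i, q_i⟩, bounded by ∑ (‖p_i‖² + ‖q_i‖²) / 2. -/
theorem norm_blockOperator_compressionMap_le {V W : H →L[ℂ] lp (fun _ : I => H) 2} {K : ℝ}
    (hV : ∀ u, ‖V u‖ ^ 2 ≤ K * ‖u‖ ^ 2) (hW : ∀ u, ‖W u‖ ^ 2 ≤ K * ‖u‖ ^ 2) (hK : 0 ≤ K)
    {n : ℕ} (A : Matrix (Fin n) (Fin n) (H →L[ℂ] H)) (hA : ‖blockOperator A‖ ≤ 1) :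
    ‖blockOperator (A.map (compressionMap V W))‖ ≤ K := by
  refine ContinuousLinearMap.opNorm_le_of_re_inner_le (𝕜 := ℂ) hK fun v u hv hu => ?_
  have hsq (V : H →L[ℂ] lp (fun _ : I => H) 2) (hV : ∀ u, ‖V u‖ ^ 2 ≤ K * ‖u‖ ^ 2)
      (u : PiLp 2 (fun _ : Fin n => H)) (hu : ‖u‖ = 1) :
      ∃ s ≤ K, HasSum (fun i => ‖WithLp.toLp 2 (fun j => V (u j) i)‖ ^ 2) s := by
    refine ⟨∑ j, ‖V (u j)‖ ^ 2, ?_, ?_⟩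
    · calc ∑ j, ‖V (u j)‖ ^ 2 ≤ ∑ j, K * ‖u j‖ ^ 2 := Finset.sum_le_sum fun j _ => hV _
        _ = K * ‖u‖ ^ 2 := by rw [PiLp.norm_sq_eq_of_L2, Finset.mul_sum]
        _ = K := by simp [hu]
    · simp only [PiLp.norm_sq_eq_of_L2]
      exact hasSum_sum fun j _ => lp.hasSum_norm_sq (V (u j))
  obtain ⟨s, hs, hsV⟩ := hsq V hV u hu
  obtain ⟨t, ht, htW⟩ := hsq W hW v hv
  have hsum : HasSum (fun i => inner ℂ (blockOperator A (WithLp.toLp 2 fun k => W (v k) i))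
      (WithLp.toLp 2 fun j => V (u j) i))
      (inner ℂ (blockOperator (A.map (compressionMap V W)) v) u) := by
    simp only [PiLp.inner_apply, blockOperator_apply, sum_inner, Matrix.map_apply]
    exact hasSum_sum fun j _ => hasSum_sum fun k _ => hasSum_inner_compressionMap V W _ _ _
  have hre := hsum.mapL Complex.reCLM
  refine (hasSum_le (fun i => ?_) hre ((htW.add hsV).div_const 2)).trans (by linarith)
  set p := WithLp.toLp 2 fun k => W (v k) i
  set q := WithLp.toLp 2 fun k => V (u k) i
  have h1 : ‖blockOperator A p‖ ≤ ‖p‖ := by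
    simpa using (blockOperator A).le_of_opNorm_le hA p
  have h2 := (Complex.re_le_norm _).trans (norm_inner_le_norm (𝕜 := ℂ) (blockOperator A p) q)
  have h3 := mul_le_mul_of_nonneg_right h1 (norm_nonneg q)
  simp only [Complex.reCLM_apply]
  nlinarith [sq_nonneg (‖p‖ - ‖q‖)]

theorem cbNorm_compressionMap_le {V W : H →L[ℂ] lp (fun _ : I => H) 2} {K : ℝ}
    (hV : ∀ u, ‖V u‖ ^ 2 ≤ K * ‖u‖ ^ 2) (hW : ∀ u, ‖W u‖ ^ 2 ≤ K * ‖u‖ ^ 2) (hK : 0 ≤ K) :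
    cbNorm (compressionMap V W) ≤ ENNReal.ofReal K := by
  refine iSup_le fun n => iSup_le fun A => iSup_le fun hA => ?_
  rw [← ofReal_norm]
  exact ENNReal.ofReal_le_ofReal (norm_blockOperator_compressionMap_le hV hW hK A hA)

end Compression

section Diagonal

variable {X I : Type*} {K : ℝ}

/-- The multiplication operator by a bounded function on `ℓ²(X)`. -/
def diagonalOperator (f : X → ℝ) (C : ℝ) (hf : ∀ x, |f x| ≤ C) : Ell2 X →L[ℂ] Ell2 X :=
  have h := lp.summable_and_tsum_le_of_norm_le
    (T := fun x : X => (f x : ℂ) • lp.evalₗ (𝕜 := ℂ) (fun _ : X => ℂ) 2 x) (C := C) fun x u => by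
      simpa using mul_le_mul_of_nonneg_right (hf x) (norm_nonneg (u x))
  lp.ofFamily (fun x => (f x : ℂ) • lp.evalₗ (𝕜 := ℂ) (fun _ : X => ℂ) 2 x) (C ^ 2)
    (fun u => (h u).1)
    fun u => (h u).2

theorem norm_diagonalOperator_sq (f : X → ℝ) (C : ℝ) (hf) (u : Ell2 X) :
    ‖diagonalOperator f C hf u‖ ^ 2 = ∑' x, ‖(f x : ℂ) * u x‖ ^ 2 :=
  (lp.hasSum_norm_sq (diagonalOperator f C hf u)).tsum_eq.symm

theorem abs_le_sqrt_of_tsum_sq_le {f : I → ℝ} (hf : Summable fun i => f i ^ 2)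
    (hK : ∑' i, f i ^ 2 ≤ K) (i : I) : |f i| ≤ √K :=
  Real.abs_le_sqrt ((hf.le_tsum i fun _ _ => sq_nonneg _).trans hK)

/-- All terms are nonnegative, so the sum over i may be taken first; it leaves a factor at most K at
each x. -/
theorem summable_and_tsum_diagonalOperator {η : X → I → ℝ}
    (hη : ∀ x, Summable fun i => η x i ^ 2) (hK : ∀ x, ∑' i, η x i ^ 2 ≤ K) {C : ℝ}
    (hC : ∀ i x, |η x i| ≤ C) (u : Ell2 X) :
    (Summable fun i => ‖diagonalOperator (η · i) C (hC i) u‖ ^ 2) ∧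
      ∑' i, ‖diagonalOperator (η · i) C (hC i) u‖ ^ 2 ≤ K * ‖u‖ ^ 2 := by
  have hu := lp.hasSum_norm_sq u
  have hterm (x : X) (i : I) : ‖(η x i : ℂ) * u x‖ ^ 2 = η x i ^ 2 * ‖u x‖ ^ 2 := by
    simp [mul_pow]
  have hle (x : X) : ∑' i, ‖(η x i : ℂ) * u x‖ ^ 2 ≤ K * ‖u x‖ ^ 2 := by
    simp only [hterm, tsum_mul_right]
    exact mul_le_mul_of_nonneg_right (hK x) (sq_nonneg _)
  have hin : Summable fun x => ∑' i, ‖(η x i : ℂ) * u x‖ ^ 2 :=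
    (hu.summable.mul_left K).of_nonneg_of_le (fun x => tsum_nonneg fun _ => sq_nonneg _) hle
  have hs : Summable fun p : X × I => ‖(η p.1 p.2 : ℂ) * u p.1‖ ^ 2 := by
    refine (summable_prod_of_nonneg fun _ => sq_nonneg _).2 ⟨fun x => ?_, hin⟩
    simp only [hterm]
    exact (hη x).mul_right _
  have hi (i : I) : ‖diagonalOperator (η · i) C (hC i) u‖ ^ 2 =
      ∑' x, ‖(η x i : ℂ) * u x‖ ^ 2 := norm_diagonalOperator_sq _ _ _ _
  have hs' : Summable fun p : I × X => ‖(η p.2 p.1 : ℂ) * u p.2‖ ^ 2 := hs.prod_symm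
  have hsum : Summable fun i => ∑' x, ‖(η x i : ℂ) * u x‖ ^ 2 := hs'.prod
  refine ⟨hsum.congr fun i => (hi i).symm, ?_⟩
  calc ∑' i, ‖diagonalOperator (η · i) C (hC i) u‖ ^ 2
      = ∑' i, ∑' x, ‖(η x i : ℂ) * u x‖ ^ 2 := tsum_congr hi
    _ = ∑' x, ∑' i, ‖(η x i : ℂ) * u x‖ ^ 2 := 
      (Summable.tsum_comm (f := fun i x => ‖(η x i : ℂ) * u x‖ ^ 2) hs').symm
    _ ≤ ∑' x, K * ‖u x‖ ^ 2 := hin.tsum_le_tsum hle (hu.summable.mul_left K)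
    _ = K * ‖u‖ ^ 2 := (hu.mul_left K).tsum_eq

/-- The operator `δ_x ↦ δ_x ⊗ η x` from `ℓ²(X)` to `ℓ²(I; ℓ²(X))`. -/
def diagonalColumn (η : X → I → ℝ) (K : ℝ) (hη : ∀ x, Summable fun i => η x i ^ 2)
    (hK : ∀ x, ∑' i, η x i ^ 2 ≤ K) : Ell2 X →L[ℂ] lp (fun _ : I => Ell2 X) 2 :=
  have hC (i : I) (x : X) : |η x i| ≤ √K := abs_le_sqrt_of_tsum_sq_le (hη x) (hK x) i
  have h := summable_and_tsum_diagonalOperator hη hK hC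
  lp.ofFamily (fun i => (diagonalOperator (η · i) (√K) (hC i) : Ell2 X →ₗ[ℂ] Ell2 X)) K
    (fun u => (h u).1) fun u => (h u).2

theorem norm_diagonalColumn_sq_le (η : X → I → ℝ) (K : ℝ) (hη) (hK) (u : Ell2 X) :
    ‖diagonalColumn η K hη hK u‖ ^ 2 ≤ K * ‖u‖ ^ 2 :=
  have h := summable_and_tsum_diagonalOperator hη hK
    fun i x => abs_le_sqrt_of_tsum_sq_le (hη x) (hK x) i
  lp.norm_ofFamily_sq_le _ K (fun u => (h u).1) (fun u => (h u).2) u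

open Classical in
theorem diagonalColumn_single (η : X → I → ℝ) (K : ℝ) (hη) (hK) (x : X) (i : I) :
    diagonalColumn η K hη hK (lp.single 2 x (1 : ℂ)) i = (η x i : ℂ) • lp.single 2 x (1 : ℂ) := by
  ext z
  change (η z i : ℂ) * (Pi.single x (1 : ℂ) : X → ℂ) z = η x i * (Pi.single x (1 : ℂ) : X → ℂ) z
  rcases eq_or_ne z x with rfl | h
  · rfl
  · simp [h]

open Classical in
theorem inner_single_apply_single (A : BEll2 X) (x y : X) :
    inner ℂ (A (lp.single 2 y (1 : ℂ))) (lp.single 2 x (1 : ℂ)) =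
      starRingEnd ℂ (matrixCoeff A x y) := by
  rw [lp.inner_single_right, matrixCoeff]
  simp

/-- A kernel of the form `κ x y = ⟨η x, ζ y⟩` with `‖η x‖², ‖ζ y‖² ≤ K` is a Schur multiplier of
completely bounded norm at most `K`. -/
theorem schurCbNorm_le_of_hasSum {η ζ : X → I → ℝ} (hη : ∀ x, Summable fun i => η x i ^ 2)
    (hηK : ∀ x, ∑' i, η x i ^ 2 ≤ K) (hζ : ∀ x, Summable fun i => ζ x i ^ 2)
    (hζK : ∀ x, ∑' i, ζ x i ^ 2 ≤ K) (hK : 0 ≤ K) {κ : X → X → ℝ}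
    (hκ : ∀ x y, HasSum (fun i => η x i * ζ y i) (κ x y)) :
    schurCbNorm (fun x y => (κ x y : ℂ)) ≤ ENNReal.ofReal K := by
  classical
  set V := diagonalColumn η K hη hηK
  set W := diagonalColumn ζ K hζ hζK
  refine (iInf₂_le (compressionMap V W) ?_).trans
    (cbNorm_compressionMap_le (norm_diagonalColumn_sq_le η K hη hηK)
      (norm_diagonalColumn_sq_le ζ K hζ hζK) hK)
  intro A x y
  have h1 := hasSum_inner_compressionMap V W A (lp.single 2 y (1 : ℂ)) (lp.single 2 x (1 : ℂ))
  simp only [V, W, diagonalColumn_single, map_smul, inner_smul_left, inner_smul_right,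
    inner_single_apply_single, Complex.conj_ofReal] at h1
  have h2 : HasSum (fun i => ((η x i * ζ y i : ℝ) : ℂ)) (κ x y) := by exact_mod_cast hκ x y
  have h3 := h1.unique ((h2.mul_right (starRingEnd ℂ (matrixCoeff A x y))).congr_fun fun i => by
    push_cast; ring)
  -- The inner product is conjugate-linear in its first argument, so `h3` is the conjugate of the
  -- desired identity.
  apply (starRingEnd ℂ).injective
  rw [h3, map_mul, Complex.conj_ofReal]

end Diagonal
end

/-! ### Radial kernels as inner products -/

noncomputable section

/-- Each integer is N / 2 for exactly two N, one of each parity; this is the factor 2 in the final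
bound. -/
theorem HasSum.int_ediv_two {F : ℤ → ℝ} {s : ℝ} (h : HasSum F s) :
    HasSum (fun N : ℤ => F (N / 2)) (s + s) := by
  have key (r : ℤ) (hr0 : 0 ≤ r) (hr : r < 2) :
      HasSum (fun N : ℤ => if N % 2 = r then F (N / 2) else 0) s := by
    have hinj : Function.Injective fun k : ℤ => 2 * k + r := fun a b hab => by
      simp only at hab
      omega
    refine (hinj.hasSum_iff fun N hN => if_neg fun h => hN ⟨N / 2, ?_⟩).1 ?_
    · simp only
      omega
    · refine h.congr_fun fun k => ?_
      have h1 : (2 * k + r) % 2 = r := by omega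
      have h2 : (2 * k + r) / 2 = k := by omega
      simp only [Function.comp_apply, h1, h2, if_true]
  convert (key 0 le_rfl two_pos).add (key 1 zero_le_one one_lt_two) using 2 with N
  rcases Int.emod_two_eq_zero_or_one N with h | h <;> simp [h]

theorem HasSum.int_add_one_ediv_two {F : ℤ → ℝ} {s : ℝ} (h : HasSum F s) :
    HasSum (fun N : ℤ => F ((N + 1) / 2)) (s + s) :=
  (Equiv.addRight (1 : ℤ)).hasSum_iff (f := fun N : ℤ => F (N / 2)) |>.2 h.int_ediv_two

theorem hasSum_int_of_le {f : ℤ → ℝ} {s : ℝ} (m : ℤ) (hf : ∀ t, m < t → f t = 0)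
    (h : HasSum (fun k : ℕ => f (m - k)) s) : HasSum f s := by
  have hinj : Function.Injective fun k : ℕ => m - (k : ℤ) := fun a b hab => by
    simpa using hab
  refine (hinj.hasSum_iff fun t ht => hf t ?_).1 h
  by_contra! hle
  exact ht ⟨(m - t).toNat, by simp only; omega⟩

theorem summable_mul_of_sq {I : Type*} {f g : I → ℝ} (hf : Summable fun i => f i ^ 2)
    (hg : Summable fun i => g i ^ 2) : Summable fun i => f i * g i := by
  refine Summable.of_norm_bounded (hf.add hg) fun i => ?_
  rw [Real.norm_eq_abs, abs_le]
  constructor <;> nlinarith [sq_nonneg (f i + g i), sq_nonneg (f i - g i)]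

theorem HasSum.mul_indicator {J A : Type*} {f : J → ℝ} {v : ℝ} (hf : HasSum f v)
    (P : Finset A) (s : A → ℝ) :
    HasSum (fun p : J × A => f p.1 * (P : Set A).indicator s p.2) (v * ∑ ω ∈ P, s ω) := by
  have hP : HasSum ((P : Set A).indicator s) (∑ ω ∈ P, s ω) := by
    rw [← Finset.sum_indicator_subset s subset_rfl]
    exact hasSum_sum_of_ne_finset_zero fun ω h => Set.indicator_of_notMem h s
  exact hf.mul hP (summable_mul_of_summable_norm hf.summable.abs hP.summable.abs)

theorem sum_nonempty_subsets_neg_one_pow {A : Type*} [DecidableEq A] (S : Finset A) :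
    ∑ ω ∈ S.powerset.erase ∅, (-1 : ℝ) ^ (ω.card + 1) = if S.Nonempty then 1 else 0 := by
  have h := S.sum_powerset_neg_one_pow_card
  have h' : ∑ ω ∈ S.powerset, (-1 : ℝ) ^ ω.card = if S = ∅ then 1 else 0 := by exact_mod_cast h
  rw [← Finset.add_sum_erase _ _ (Finset.empty_mem_powerset S)] at h'
  simp only [pow_succ, mul_neg, mul_one, Finset.sum_neg_distrib]
  rcases S.eq_empty_or_nonempty with rfl | hS
  · simp
  · rw [if_neg hS.ne_empty] at h'
    simp only [Finset.card_empty, pow_zero] at h'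
    rw [if_pos hS]
    linarith

section Vector

variable {J A : Type*}

/-- The vector `⊕_N ⊕_j α_j(ℓ - σ N) ∑_{ω ∈ P (σ N)} s(ω) δ_ω`. -/
def levelVector (α : J → ℕ → ℝ) (s : A → ℝ) (P : ℤ → Finset A) (ℓ : ℤ) (σ : ℤ → ℤ) :
    ℤ × J × A → ℝ :=
  fun i => α i.2.1 (ℓ - σ i.1).toNat * (P (σ i.1) : Set A).indicator s i.2.2

/-- The part over N has squared norm a(ℓ - σ N) |P (σ N)|, and by `hσ` summing over N counts the
levels twice. Levels above ℓ contribute nothing, so the truncation in `toNat` is harmless. -/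
theorem levelVector_sq_summable_and_tsum_le {α : J → ℕ → ℝ} {a : ℕ → ℝ} {K : ℝ}
    (hα : ∀ k, HasSum (fun j => α j k ^ 2) (a k)) (ha : HasSum a K) {s : A → ℝ}
    (hs : ∀ ω, s ω ^ 2 = 1) {P : ℤ → Finset A} {B : ℕ} (hB : ∀ t, (P t).card ≤ B) {ℓ : ℤ}
    (hP : ∀ t, ℓ < t → P t = ∅) {σ : ℤ → ℤ}
    (hσ : ∀ (F : ℤ → ℝ) (s : ℝ), HasSum F s → HasSum (fun N => F (σ N)) (s + s)) :
    (Summable fun i => levelVector α s P ℓ σ i ^ 2) ∧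
      ∑' i, levelVector α s P ℓ σ i ^ 2 ≤ 2 * (K * B) := by
  have ha0 (k : ℕ) : 0 ≤ a k := (hα k).nonneg fun j => sq_nonneg (α j k)
  have hfib (N : ℤ) : HasSum (fun p : J × A => levelVector α s P ℓ σ (N, p) ^ 2)
      (a (ℓ - σ N).toNat * (P (σ N)).card) := by
    have h := (hα (ℓ - σ N).toNat).mul_indicator (P (σ N)) fun _ => 1
    simp only [Finset.sum_const, nsmul_eq_mul, mul_one] at h
    refine h.congr_fun fun p => ?_
    by_cases hp : p.2 ∈ P (σ N) <;> simp [levelVector, mul_pow, hp, hs]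
  have hmaj : HasSum (fun t : ℤ => if t ≤ ℓ then a (ℓ - t).toNat * (B : ℝ) else 0) (K * B) := by
    refine hasSum_int_of_le ℓ (fun t ht => if_neg (not_le.2 ht)) ?_
    simpa using ha.mul_right (B : ℝ)
  have hle (N : ℤ) : a (ℓ - σ N).toNat * ((P (σ N)).card : ℝ) ≤
      if σ N ≤ ℓ then a (ℓ - σ N).toNat * (B : ℝ) else 0 := by
    split_ifs with h
    · exact mul_le_mul_of_nonneg_left (by exact_mod_cast hB _) (ha0 _)
    · simp [hP _ (not_le.1 h)]
  have hmaj' := hσ _ _ hmaj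
  have hsum : Summable fun N => a (ℓ - σ N).toNat * ((P (σ N)).card : ℝ) :=
    hmaj'.summable.of_nonneg_of_le (fun N => mul_nonneg (ha0 _) (Nat.cast_nonneg _)) hle
  have htot : Summable fun i => levelVector α s P ℓ σ i ^ 2 := by
    refine (summable_prod_of_nonneg fun _ => sq_nonneg _).2 ⟨fun N => (hfib N).summable, ?_⟩
    exact hsum.congr fun N => (hfib N).tsum_eq.symm
  refine ⟨htot, ?_⟩
  rw [two_mul]
  exact hasSum_le hle (htot.hasSum.prod_fiberwise hfib) hmaj'

end Vector

section Kernel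

variable {V J : Type*} [DecidableEq V]

/-- A radial kernel `f(d(x, y))` is a Schur multiplier as soon as the metric is encoded by uniformly
finite sets `S x t` and the Hankel matrix `c(k + l)` of `c(n) = f(n) - f(n + 1)` has a
Hilbert–Schmidt factorization. -/
theorem schurCbNorm_radial_le {d : V → V → ℕ} {ℓ : V → ℤ} {S : V → ℤ → Finset V} {B : ℕ}
    (hB : ∀ x t, 2 ^ (S x t).card ≤ B) (hℓ : ∀ x t, ℓ x < t → S x t = ∅)
    (hS : ∀ x y N, (S x ((N + 1) / 2) ∩ S y (N / 2)).Nonempty ↔ N + d x y ≤ ℓ x + ℓ y)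
    {α β : J → ℕ → ℝ} {a c f : ℕ → ℝ} {K : ℝ} (hα : ∀ k, HasSum (fun j => α j k ^ 2) (a k))
    (hβ : ∀ k, HasSum (fun j => β j k ^ 2) (a k)) (ha : HasSum a K)
    (hc : ∀ k l, HasSum (fun j => α j k * β j l) (c (k + l)))
    (hf : ∀ n, HasSum (fun m => c (n + m)) (f n)) :
    schurCbNorm (fun x y => (f (d x y) : ℂ)) ≤ ENNReal.ofReal (2 * (K * B)) := by
  have hcard (x : V) (t : ℤ) : ((S x t).powerset.erase ∅).card ≤ B :=
    (Finset.card_erase_le.trans_eq (Finset.card_powerset _)).trans (hB x t)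
  have hempty (x : V) (t : ℤ) (ht : ℓ x < t) : (S x t).powerset.erase ∅ = ∅ := by
    rw [hℓ x t ht]; rfl
  have hη (x : V) := levelVector_sq_summable_and_tsum_le hα ha (s := fun _ => 1) (by simp)
    (hcard x) (hempty x) fun F s h => h.int_add_one_ediv_two
  have hζ (x : V) := levelVector_sq_summable_and_tsum_le hβ ha
    (s := fun ω : Finset V => (-1) ^ (ω.card + 1)) (fun ω => by rw [← pow_mul, mul_comm, pow_mul]; simp)
    (hcard x) (hempty x) fun F s h => h.int_ediv_two
  have hK : 0 ≤ K := ha.nonneg fun k => (hα k).nonneg fun _ => sq_nonneg _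
  refine schurCbNorm_le_of_hasSum (fun x => (hη x).1) (fun x => (hη x).2) (fun x => (hζ x).1)
    (fun x => (hζ x).2) (by positivity) fun x y => ?_
  have htot := (summable_mul_of_sq (hη x).1 (hζ y).1).hasSum
  have hfib (N : ℤ) : HasSum (fun p : J × Finset V =>
      levelVector α (fun _ => 1) (fun t => (S x t).powerset.erase ∅) (ℓ x) (fun N => (N + 1) / 2)
        (N, p) * levelVector β (fun ω => (-1) ^ (ω.card + 1)) (fun t => (S y t).powerset.erase ∅)
        (ℓ y) (fun N => N / 2) (N, p))
      (if N ≤ ℓ x + ℓ y - d x y then c (ℓ x + ℓ y - N).toNat else 0) := by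
    -- Only sets ω contained in both S x and S y survive in the product, that is, the nonempty
    -- subsets of the intersection.
    have h := (hc (ℓ x - (N + 1) / 2).toNat (ℓ y - N / 2).toNat).mul_indicator
      ((S x ((N + 1) / 2) ∩ S y (N / 2)).powerset.erase ∅) fun ω => (-1) ^ (ω.card + 1)
    rw [sum_nonempty_subsets_neg_one_pow] at h
    convert h using 1
    · ext p
      simp only [levelVector, Set.indicator_apply, Finset.mem_coe, Finset.mem_erase,
        Finset.mem_powerset, Finset.subset_inter_iff]
      by_cases h0 : p.2 ≠ ∅ <;> by_cases h1 : p.2 ⊆ S x ((N + 1) / 2) <;>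
        by_cases h2 : p.2 ⊆ S y (N / 2) <;> simp [h0, h1, h2, mul_assoc]
    · simp only [hS]
      by_cases hN : N ≤ ℓ x + ℓ y - d x y
      · rw [if_pos hN, if_pos (by omega), mul_one]
        -- Nonemptiness puts both levels below ℓ x and ℓ y, so the two `toNat` values are exact and
        -- add up to ℓ x + ℓ y - N.
        obtain ⟨w, hw⟩ := (hS x y N).2 (by omega)
        rw [Finset.mem_inter] at hw
        have h1 : (N + 1) / 2 ≤ ℓ x := by
          by_contra! h
          simp [hℓ x _ h] at hw
        have h2 : N / 2 ≤ ℓ y := by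
          by_contra! h
          simp [hℓ y _ h] at hw
        congr 1
        omega
      · rw [if_neg hN, if_neg (by omega), mul_zero]
  have h1 := htot.prod_fiberwise hfib
  have h2 : HasSum (fun N : ℤ => if N ≤ ℓ x + ℓ y - d x y then c (ℓ x + ℓ y - N).toNat else 0)
      (f (d x y)) := by
    refine hasSum_int_of_le (ℓ x + ℓ y - d x y) (fun t ht => if_neg (not_le.2 ht)) ?_
    refine (hf (d x y)).congr_fun fun m => ?_
    rw [if_pos (by omega)]
    congr 1
    omega
  exact h1.unique h2 ▸ htot

end Kernel
end

/-! ### Factorization of truncated geometric Hankel matrices -/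

noncomputable section

section HankelFactorization

variable {r : ℝ} {M : ℕ}

/-- The entries, in the row `k`, of a Hilbert–Schmidt factor of the truncated geometric Hankel
matrix: a rank one part, and a correction for each matrix position `(i, j)` with `i + j > M`. -/
def hankelFactor (r : ℝ) (M : ℕ) (ε : ℝ) (pr : ℕ × ℕ → ℕ) : Unit ⊕ (ℕ × ℕ) → ℕ → ℝ
  | .inl _, k => √(1 - r) * r ^ k
  | .inr p, k => if pr p = k ∧ M < p.1 + p.2 then ε * √((1 - r) * r ^ (p.1 + p.2)) else 0

/-- `e k` enumerates the matrix positions in line k, so rows and columns are treated at once. The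
corrections in that line form a geometric tail starting at exponent max k (M + 1). -/
theorem hasSum_hankelFactor_sq (hr0 : 0 < r) (hr1 : r < 1) {ε : ℝ} (hε : ε ^ 2 = 1)
    {pr : ℕ × ℕ → ℕ} {e : ℕ → ℕ → ℕ × ℕ} (hinj : ∀ k, Function.Injective (e k))
    (hsum : ∀ k l, (e k l).1 + (e k l).2 = k + l) (hpr : ∀ p k, pr p = k ↔ ∃ l, e k l = p)
    (k : ℕ) :
    HasSum (fun j => hankelFactor r M ε pr j k ^ 2) ((1 - r) * r ^ (2 * k) + r ^ max k (M + 1)) := by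
  have h1r : 0 < 1 - r := sub_pos.2 hr1
  refine HasSum.sum ?_ ?_
  · convert hasSum_unique (fun _ : Unit => (1 - r) * r ^ (2 * k)) using 1
    ext
    simp only [Function.comp_apply, hankelFactor, mul_pow, Real.sq_sqrt h1r.le]
    ring
  · have hi : Function.Injective fun l => e k (M + 1 - k + l) :=
      (hinj k).comp (add_right_injective _)
    refine (hi.hasSum_iff ?_).1 ?_
    · intro p hp
      have : ¬ (pr p = k ∧ M < p.1 + p.2) := by
        rintro ⟨h1, h2⟩
        obtain ⟨l, rfl⟩ := (hpr p k).1 h1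
        rw [hsum] at h2
        exact hp ⟨l - (M + 1 - k), by simp only; congr 1; omega⟩
      simp [hankelFactor, this]
    · have h := (hasSum_geometric_of_lt_one hr0.le hr1).mul_left ((1 - r) * r ^ max k (M + 1))
      rw [mul_right_comm, mul_inv_cancel₀ h1r.ne', one_mul] at h
      refine h.congr_fun fun l => ?_
      have h1 : pr (e k (M + 1 - k + l)) = k := (hpr _ _).2 ⟨_, rfl⟩
      have h2 : M < k + (M + 1 - k + l) := by omega
      have h3 : k + (M + 1 - k + l) = max k (M + 1) + l := by omega
      simp only [Function.comp_apply, hankelFactor, hsum, h1, h2, and_self, if_true, mul_pow, hε,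
        one_mul]
      rw [Real.sq_sqrt (by positivity), h3, pow_add, mul_assoc]

/-- Among the corrections only the position (k, l) survives; with the opposite signs 1 and -1 it
cancels the rank one entry when k + l > M. -/
theorem hasSum_hankelFactor_mul (hr0 : 0 < r) (hr1 : r < 1) (k l : ℕ) :
    HasSum (fun j => hankelFactor r M 1 Prod.fst j k * hankelFactor r M (-1) Prod.snd j l)
      (if k + l ≤ M then (1 - r) * r ^ (k + l) else 0) := by
  have h1r : 0 < 1 - r := sub_pos.2 hr1
  have h1 : HasSum (fun _ : Unit => (1 - r) * r ^ (k + l)) ((1 - r) * r ^ (k + l)) := by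
    exact hasSum_unique (fun _ : Unit => (1 - r) * r ^ (k + l))
  have h2 : HasSum (fun p => hankelFactor r M 1 Prod.fst (.inr p) k *
      hankelFactor r M (-1) Prod.snd (.inr p) l)
      (if k + l ≤ M then 0 else -((1 - r) * r ^ (k + l))) := by
    convert hasSum_single (k, l) ?_ using 1
    · by_cases h : k + l ≤ M
      · simp [hankelFactor, h]
      · have h' := not_le.1 h
        simp only [hankelFactor, h, h', and_self, if_true, if_false]
        rw [mul_mul_mul_comm, Real.mul_self_sqrt (by positivity)]
        ring
    · rintro ⟨a, b⟩ hab
      by_cases ha : a = k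
      · have hb : b ≠ l := fun hb => hab (by rw [ha, hb])
        simp [hankelFactor, hb]
      · simp [hankelFactor, ha]
  convert HasSum.sum (f := fun j => hankelFactor r M 1 Prod.fst j k *
    hankelFactor r M (-1) Prod.snd j l) (h1.congr_fun fun _ => ?_) h2 using 1
  · split_ifs <;> ring
  · simp only [Function.comp_apply, hankelFactor]
    rw [mul_mul_mul_comm, Real.mul_self_sqrt h1r.le, pow_add]

/-- The rank one part contributes 1 / (1 + r) ≤ 1; the M + 1 lines k ≤ M and the geometric tail
beyond them contribute at most 1 / 2 each. -/
theorem exists_hasSum_hankelFactor_bound (hr0 : 0 < r) (hr1 : r < 1)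
    (hM : ((M + 1 : ℕ) : ℝ) * r ^ (M + 1) ≤ 1 / 2) (hM' : r ^ (M + 1) ≤ (1 - r) / 2) :
    ∃ K ≤ 2, HasSum (fun k => (1 - r) * r ^ (2 * k) + r ^ max k (M + 1)) K := by
  have h1r : 0 < 1 - r := sub_pos.2 hr1
  have hr2 : r ^ 2 < 1 := pow_lt_one₀ hr0.le hr1 two_ne_zero
  have h1 : HasSum (fun k => (1 - r) * r ^ (2 * k)) ((1 - r) * (1 - r ^ 2)⁻¹) := by
    simpa only [pow_mul] using
      (hasSum_geometric_of_lt_one (sq_nonneg r) hr2).mul_left (1 - r)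
  have h2 : HasSum (fun k => r ^ max k (M + 1))
      (r ^ (M + 1) * (1 - r)⁻¹ + ∑ k ∈ Finset.range (M + 1), r ^ max k (M + 1)) := by
    refine (hasSum_nat_add_iff (M + 1)).1 ?_
    refine ((hasSum_geometric_of_lt_one hr0.le hr1).mul_left _).congr_fun fun k => ?_
    rw [max_eq_left (by omega), pow_add, mul_comm]
  refine ⟨_, ?_, h1.add h2⟩
  have h3 : ∑ k ∈ Finset.range (M + 1), r ^ max k (M + 1) = ((M + 1 : ℕ) : ℝ) * r ^ (M + 1) := by
    rw [Finset.sum_congr rfl fun k hk => by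
      rw [max_eq_right (Finset.mem_range.1 hk).le]]
    simp
  have h4 : (1 - r) * (1 - r ^ 2)⁻¹ ≤ 1 := by
    rw [← div_eq_mul_inv, div_le_one (by linarith)]
    nlinarith
  have h5 : r ^ (M + 1) * (1 - r)⁻¹ ≤ 1 / 2 := by
    rw [← div_eq_mul_inv, div_le_iff₀ h1r]
    linarith
  rw [h3]
  linarith

end HankelFactorization

/-- The function `r ^ n - r ^ (M + 1)`, cut off at `M`. -/
def truncatedPower (r : ℝ) (M n : ℕ) : ℝ := if n ≤ M then r ^ n - r ^ (M + 1) else 0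

theorem hasSum_truncatedPower (r : ℝ) (M n : ℕ) :
    HasSum (fun m => if n + m ≤ M then (1 - r) * r ^ (n + m) else 0) (truncatedPower r M n) := by
  convert hasSum_sum_of_ne_finset_zero (L := .unconditional ℕ) (s := Finset.range (M + 1 - n)) ?_ using 1
  · rw [Finset.sum_congr rfl fun m hm => if_pos (by have := Finset.mem_range.1 hm; omega)]
    simp only [pow_add r n, ← mul_assoc]
    rw [← Finset.mul_sum, truncatedPower, mul_comm (1 - r), mul_assoc, mul_neg_geom_sum]
    split_ifs with h
    · rw [mul_sub, ← pow_add, mul_one]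
      rw [show n + (M + 1 - n) = M + 1 by omega]
    · simp [Nat.sub_eq_zero_of_le (show M + 1 ≤ n by omega)]
  · intro m hm
    rw [Finset.mem_range] at hm
    exact if_neg (by omega)

theorem truncatedPower_mem_Icc {r : ℝ} (hr0 : 0 < r) (hr1 : r < 1) (M n : ℕ) :
    truncatedPower r M n ∈ Set.Icc (0 : ℝ) 1 := by
  unfold truncatedPower
  split_ifs with h
  · have h1 := pow_le_pow_of_le_one hr0.le hr1.le (Nat.le_succ_of_le h)
    have h2 := pow_le_one₀ (n := n) hr0.le hr1.le
    have h3 := pow_pos hr0 (M + 1)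
    constructor <;> simp only [Nat.succ_eq_add_one] at * <;> linarith
  · simp

theorem truncatedPower_support_subset (r : ℝ) (M : ℕ) :
    Function.support (truncatedPower r M) ⊆ Set.Iic M := fun n hn => by
  by_contra h
  exact hn (if_neg h)

theorem exists_truncation_level {r : ℝ} (hr0 : 0 < r) (hr1 : r < 1) (n : ℕ) :
    ∃ M, n ≤ M ∧ ((M + 1 : ℕ) : ℝ) * r ^ (M + 1) ≤ 1 / 2 ∧ r ^ (M + 1) ≤ (1 - r) / 2 := by
  have h1 := (tendsto_self_mul_const_pow_of_lt_one hr0.le hr1).comp (tendsto_add_atTop_nat 1)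
  have h2 := (tendsto_pow_atTop_nhds_zero_of_lt_one hr0.le hr1).comp (tendsto_add_atTop_nat 1)
  obtain ⟨M, hM, hM1, hM2⟩ := ((eventually_ge_atTop n).and
    ((h1.eventually_le_const one_half_pos).and
      (h2.eventually_le_const (half_pos (sub_pos.2 hr1))))).exists
  exact ⟨M, hM, hM1, hM2⟩

/-- There are parameters for which the truncated powers tend to `1` and satisfy the smallness conditions
under which they are uniformly bounded Schur multipliers. -/
theorem exists_approximate_unit_truncatedPower :
    ∃ (r : ℕ → ℝ) (M : ℕ → ℕ), (∀ n, 0 < r n ∧ r n < 1) ∧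
      (∀ n, ((M n + 1 : ℕ) : ℝ) * r n ^ (M n + 1) ≤ 1 / 2 ∧ r n ^ (M n + 1) ≤ (1 - r n) / 2) ∧
      ∀ m, Tendsto (fun n => truncatedPower (r n) (M n) m) atTop (𝓝 1) := by
  -- The denominator is n + 2, so that r 0 = 1 / 2 is already positive.
  let r : ℕ → ℝ := fun n => 1 - 1 / ((n + 1 : ℕ) + 1 : ℝ)
  have hr (n : ℕ) : 0 < r n ∧ r n < 1 := by
    have h1 : (1 : ℝ) < (n + 1 : ℕ) + 1 := by
      have : (0 : ℝ) < (n + 1 : ℕ) := by positivity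
      linarith
    exact ⟨sub_pos.2 ((div_lt_one (by linarith)).2 h1), sub_lt_self _ (by positivity)⟩
  choose M hM hM1 hM2 using fun n => exists_truncation_level (hr n).1 (hr n).2 n
  refine ⟨r, M, hr, fun n => ⟨hM1 n, hM2 n⟩, fun m => ?_⟩
  have hlim : Tendsto r atTop (𝓝 1) := by
    have := (tendsto_one_div_add_atTop_nhds_zero_nat (𝕜 := ℝ)).comp (tendsto_add_atTop_nat 1)
    simpa [r] using this.const_sub 1
  have h1 : Tendsto (fun n => r n ^ (M n + 1)) atTop (𝓝 0) := by
    refine squeeze_zero (fun n => (pow_pos (hr n).1 _).le) hM2 ?_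
    simpa using (hlim.const_sub 1).div_const 2
  have h2 := (hlim.pow m).sub h1
  rw [one_pow, sub_zero] at h2
  refine h2.congr' ?_
  filter_upwards [eventually_ge_atTop m] with n hn
  rw [truncatedPower, if_pos (hn.trans (hM n))]

/-! ### Uniform bounds and application to hyperbolic groups -/

theorem schurCbNorm_truncatedPower_le {V : Type*} {d : V → V → ℕ} {ℓ : V → ℤ}
    {S : V → ℤ → Finset V} {B : ℕ} [DecidableEq V]
    (hB : ∀ x t, 2 ^ (S x t).card ≤ B) (hℓ : ∀ x t, ℓ x < t → S x t = ∅)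
    (hS : ∀ x y N, (S x ((N + 1) / 2) ∩ S y (N / 2)).Nonempty ↔ N + d x y ≤ ℓ x + ℓ y)
    {r : ℝ} {M : ℕ} (hr0 : 0 < r) (hr1 : r < 1)
    (hM : ((M + 1 : ℕ) : ℝ) * r ^ (M + 1) ≤ 1 / 2) (hM' : r ^ (M + 1) ≤ (1 - r) / 2) :
    schurCbNorm (fun x y => (truncatedPower r M (d x y) : ℂ)) ≤
      ENNReal.ofReal (2 * (2 * B)) := by
  obtain ⟨K, hK, hsum⟩ := exists_hasSum_hankelFactor_bound hr0 hr1 hM hM'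
  have hα : ∀ k, HasSum (fun j => hankelFactor r M 1 Prod.fst j k ^ 2)
      ((1 - r) * r ^ (2 * k) + r ^ max k (M + 1)) := by
    refine hasSum_hankelFactor_sq hr0 hr1 (one_pow 2) (e := fun k l => (k, l))
      (fun k a b h => by simpa using h) (fun k l => rfl) fun p k => ?_
    exact ⟨fun h => ⟨p.2, by rw [← h]⟩, fun ⟨l, h⟩ => by rw [← h]⟩
  have hβ : ∀ k, HasSum (fun j => hankelFactor r M (-1) Prod.snd j k ^ 2)
      ((1 - r) * r ^ (2 * k) + r ^ max k (M + 1)) := by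
    refine hasSum_hankelFactor_sq hr0 hr1 (by norm_num) (e := fun k l => (l, k))
      (fun k a b h => by simpa using h) (fun k l => add_comm _ _) fun p k => ?_
    exact ⟨fun h => ⟨p.1, by rw [← h]⟩, fun ⟨l, h⟩ => by rw [← h]⟩
  have h := schurCbNorm_radial_le hB hℓ hS hα hβ hsum
    (c := fun n => if n ≤ M then (1 - r) * r ^ n else 0) (f := truncatedPower r M)
    (hasSum_hankelFactor_mul hr0 hr1) (hasSum_truncatedPower r M)
  refine h.trans (ENNReal.ofReal_le_ofReal ?_)
  gcongr

/-- The uniformly finite sets encoding the metric of a hyperbolic Cayley graph. -/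
theorem IsHyperbolicGeneratingSet.exists_encoding {G : Type*} [Group G] [DecidableEq G] {S : Set G}
    (hS : IsHyperbolicGeneratingSet S) :
    ∃ (T : G → ℤ → Finset G) (B : ℕ), (∀ x t, 2 ^ (T x t).card ≤ B) ∧
      (∀ x t, (wordLength S x : ℤ) < t → T x t = ∅) ∧
      ∀ x y N, (T x ((N + 1) / 2) ∩ T y (N / 2)).Nonempty ↔
        N + (SimpleGraph.mulCayley S).dist x y ≤ (wordLength S x : ℤ) + wordLength S y := by
  obtain ⟨hfin, -, hhyp⟩ := hS
  have hc := hhyp.1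
  obtain ⟨D, hD⟩ := hhyp.exists_four_point
  set R := 3 * D + 2
  have hsub (x : G) (t : ℤ) := exists_descentSet_subset_closedBall hc hD 1 R x t
  have hfinT (x : G) (t : ℤ) : (descentSet (SimpleGraph.mulCayley S) 1 R x t).Finite := by
    obtain ⟨u, hu⟩ := hsub x t
    exact (SimpleGraph.mulCayley_finite_closedBall hfin hc u _).subset hu
  refine ⟨fun x t => (hfinT x t).toFinset,
    2 ^ {g | (SimpleGraph.mulCayley S).dist 1 g ≤ R + D}.ncard, fun x t => ?_, fun x t ht => ?_,
    fun x y N => ?_⟩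
  · obtain ⟨u, hu⟩ := hsub x t
    refine Nat.pow_le_pow_right two_pos ?_
    rw [← Set.ncard_eq_toFinset_card _ (hfinT x t), ← SimpleGraph.mulCayley_ncard_closedBall S u]
    exact Set.ncard_le_ncard hu (SimpleGraph.mulCayley_finite_closedBall hfin hc u _)
  · rw [Set.Finite.toFinset_eq_empty, Set.eq_empty_iff_forall_notMem]
    rintro w ⟨hw, -⟩
    unfold wordLength at ht
    omega
  · rw [← Finset.coe_nonempty, Finset.coe_inter, Set.Finite.coe_toFinset, Set.Finite.coe_toFinset]
    exact descentSet_inter_nonempty_iff hc hD 1 x y N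

theorem wordLength_inv_mul {G : Type*} [Group G] (S : Set G) (x y : G) :
    wordLength S (x⁻¹ * y) = (SimpleGraph.mulCayley S).dist x y := by
  rw [wordLength, ← SimpleGraph.mulCayley_dist_mul_left S x]
  simp

theorem IsHyperbolicGeneratingSet.exists_radial_witness {G : Type*} [Group G] {S : Set G}
    (hS : IsHyperbolicGeneratingSet S) :
    ∃ (C : ℝ≥0) (f : ℕ → ℕ → ℝ),
      (∀ n, (Function.support (f n)).Finite) ∧
      (∀ n m, f n m ∈ Set.Icc (0 : ℝ) 1) ∧
      (∀ m, Tendsto (fun n => f n m) atTop (𝓝 1)) ∧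
      WitnessesWeakAmenability C (fun n (g : G) => ((f n (wordLength S g) : ℝ) : ℂ)) := by
  classical
  obtain ⟨T, B, hB, hℓ, hT⟩ := hS.exists_encoding
  obtain ⟨r, M, hr, hM, hlim⟩ := exists_approximate_unit_truncatedPower
  refine ⟨Real.toNNReal (2 * (2 * B)), fun n => truncatedPower (r n) (M n),
    fun n => (Set.finite_Iic _).subset (truncatedPower_support_subset _ _),
    fun n => truncatedPower_mem_Icc (hr n).1 (hr n).2 _, hlim, fun n => ?_, fun g => ?_,
    iSup_le fun n => ?_⟩
  · refine (SimpleGraph.mulCayley_finite_closedBall_one hS.1 hS.2.2.1 (M n)).subset fun g hg => ?_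
    refine truncatedPower_support_subset (r n) (M n) fun h => hg ?_
    change ((truncatedPower (r n) (M n) (wordLength S g) : ℝ) : ℂ) = 0
    exact_mod_cast h
  · simpa [Function.comp_def] using (Complex.continuous_ofReal.tendsto 1).comp (hlim (wordLength S g))
  · simp only [multiplierCbNorm, wordLength_inv_mul]
    exact schurCbNorm_truncatedPower_le hB hℓ hT (hr n).1 (hr n).2 (hM n).1 (hM n).2

end

theorem mainTheorem2 {G : Type*} [Group G] (hG : IsHyperbolicGroup G) :
    IsWeaklyAmenable G ∧
    ∀ S : Set G, IsHyperbolicGeneratingSet S →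
      ∃ (C : ℝ≥0) (f : ℕ → ℕ → ℝ),
        (∀ n, (Function.support (f n)).Finite) ∧
        (∀ n m, f n m ∈ Set.Icc (0 : ℝ) 1) ∧
        (∀ m, Tendsto (fun n => f n m) atTop (𝓝 1)) ∧
        WitnessesWeakAmenability C (fun n (g : G) => ((f n (wordLength S g) : ℝ) : ℂ)) := by
  refine ⟨?_, fun S hS => hS.exists_radial_witness⟩
  obtain ⟨S, hS⟩ := hG
  obtain ⟨C, f, -, -, -, hf⟩ := hS.exists_radial_witness
  exact ⟨C, _, hf⟩
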